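/- An effect algebra $(E;\oplus,0,1)$ is a set with a partial binary operation $\oplus$ that is commutative and associative (one side is defined iff the other is, and then they agree), in which every $a$ has a unique $a'$ with $a\oplus a'=1$, and in which $1\oplus a$ is defined only for $a=0$. It is ordered by $a\le b$ iff $a\oplus c=b$ for some $c$, and it is a lattice effect algebra if this order is a lattice. It is Archimedean if no nonzero $e$ has all multiples $ne=e\oplus\cdots\oplus e$ defined, and atomic if every nonzero element lies above an atom. Write $\mathrm{ord}(a)=n_a$ for the greatest $n$ such that $na$ is defined. Let $S(E)=\{x\in E: x\wedge x'=0\}$ be the set of sharp elements, an effect algebra under the inherited operation when $E$ is a lattice effect algebra. $E$ is sharply dominating if every $a\in E$ has a smallest sharp element above it. A state on an effect algebra $F$ is a map $\omega:F\to[0,1]$ with $\omega(1)=1$ and $\omega(x\oplus y)=\omega(x)+\omega(y)$ whenever $x\oplus y$ is defined. It is order-continuous if $\omega(x_\alpha)\to\omega(x)$ for every net $(x_\alpha)$ in $F$ that order converges to $x$, i.e. for which there are nets $u_\alpha\le x_\alpha\le v_\alpha$ over the same directed set, with $u_\alpha$ increasing with supremum $x$ and $v_\alpha$ decreasing with infimum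 $x$. A family is $\oplus$-orthogonal if all its finite subfamilies have a sum; its sum $\bigoplus$ is then the supremum of the finite sums, if this exists. A basic decomposition of $x\in E$ is an expression $x=v\oplus\bigoplus\{k_\alpha a_\alpha:\alpha\in\Lambda\}$ with $v\in S(E)$, distinct atoms $a_\alpha$ and positive integers $k_\alpha\ne\mathrm{ord}(a_\alpha)$ ($\Lambda$ may be empty). **Theorem 4.2 (state smearing theorem).** Let $E$ be a sharply dominating Archimedean atomic lattice effect algebra, and let $\omega$ be an order-continuous state on $S(E)$. Then every $x\in E$ has exactly one basic decomposition, and there is a state $\hat\omega$ on $E$ such that 1. $\hat\omega(x)=\omega(x)$ for all $x\in S(E)$; 2. for every atom $a$ of $E$, $n_a=\mathrm{ord}(a)$ is finite and positive, $n_a a\in S(E)$, and $\hat\omega(a)=\omega(n_a a)/n_a$; 3. for every $x\in E$ with basic decomposition $x=v\oplus\bigoplus\{k_\alpha a_\alpha:\alpha\in\Lambda\}$, $$\hat\omega(x)=\omega(v)+\sup\Big\{\sum_{\alpha\in K}k_\alpha\hat\omega(a_\alpha): K\subseteq\Lambda\text{ finite}\Big\}.$$ -/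

import Mathlib

universe u v

/-- An effect algebra `(E; ⊕, 0, 1)`. The partial operation is `oplus`, with `oplus a b = none`
when `a ⊕ b` is undefined. The order is the one induced by `⊕` (field `le_iff`). -/
class EffectAlgebra (E : Type u) extends Zero E, One E, PartialOrder E where
  oplus : E → E → Option E
  oplus_comm : ∀ a b, oplus a b = oplus b a
  /-- Both sides are defined or undefined together, and agree when defined. -/
  oplus_assoc : ∀ a b c,
    ((oplus a b).bind fun d => oplus d c) = (oplus b c).bind fun d => oplus a d
  existsUnique_orth : ∀ a, ∃! b, oplus a b = some 1
  eq_zero_of_one_oplus : ∀ a c, oplus 1 a = some c → a = 0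
  le_iff : ∀ a b, a ≤ b ↔ ∃ c, oplus a c = some b

/-- A lattice effect algebra: the induced order is a lattice. -/
class LatticeEffectAlgebra (E : Type u) extends EffectAlgebra E, Lattice E

namespace EffectAlgebra

section Basic

variable {E : Type u} [EffectAlgebra E]

/-- The orthosupplement `a'`, the unique element with `a ⊕ a' = 1`. -/
noncomputable def orth (a : E) : E := (existsUnique_orth a).choose

theorem oplus_orth (a : E) : oplus a (orth a) = some 1 :=
  (existsUnique_orth a).choose_spec.1

theorem eq_orth {a b : E} (h : oplus a b = some 1) : b = orth a :=
  (existsUnique_orth a).choose_spec.2 b h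

theorem orth_orth (a : E) : orth (orth a) = a :=
  (eq_orth (by rw [oplus_comm]; exact oplus_orth a)).symm

theorem assoc_right {a b c d e : E} (h : oplus a b = some d) (h' : oplus d c = some e) :
    ∃ f, oplus b c = some f ∧ oplus a f = some e := by
  have := oplus_assoc a b c
  rw [h, Option.bind_some, h'] at this
  exact Option.bind_eq_some_iff.1 this.symm

theorem assoc_left {a b c e f : E} (h : oplus b c = some f) (h' : oplus a f = some e) :
    ∃ d, oplus a b = some d ∧ oplus d c = some e := by
  have := oplus_assoc a b c
  rw [h, Option.bind_some, h'] at this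
  exact Option.bind_eq_some_iff.1 this

theorem one_oplus_zero : oplus (1 : E) 0 = some 1 := by
  have h := oplus_orth (1 : E)
  rwa [eq_zero_of_one_oplus _ _ h] at h

theorem oplus_zero (a : E) : oplus a 0 = some a := by
  have h : oplus (orth a) a = some 1 := by rw [oplus_comm]; exact oplus_orth a
  obtain ⟨f, hf, hf'⟩ := assoc_right h one_oplus_zero
  rw [hf, eq_orth hf', orth_orth]

theorem zero_oplus (a : E) : oplus 0 a = some a := by rw [oplus_comm, oplus_zero]

theorem oplus_left_cancel {a b c d : E} (h : oplus a b = some d) (h' : oplus a c = some d) :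
    b = c := by
  have key : ∀ x : E, oplus a x = some d → ∃ f, oplus (orth d) a = some f ∧ x = orth f := by
    intro x hx
    have h1 : oplus (orth d) d = some 1 := by rw [oplus_comm]; exact oplus_orth d
    obtain ⟨f, hf, hf'⟩ := assoc_left hx h1
    exact ⟨f, hf, eq_orth hf'⟩
  obtain ⟨f, hf, rfl⟩ := key b h
  obtain ⟨g, hg, rfl⟩ := key c h'
  rw [hf, Option.some.injEq] at hg
  rw [hg]

instance : BoundedOrder E where
  bot := 0
  bot_le a := (le_iff _ _).2 ⟨a, zero_oplus a⟩
  top := 1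
  le_top a := (le_iff _ _).2 ⟨orth a, oplus_orth a⟩

/-- `⊕` extended to possibly undefined arguments: a sum with an undefined term is undefined. -/
def padd (x y : Option E) : Option E := x.bind fun a => y.bind fun b => oplus a b

instance : Std.Commutative (padd (E := E)) where
  comm x y := by
    cases x <;> cases y <;> simp [padd, oplus_comm]

instance : Std.Associative (padd (E := E)) where
  assoc x y z := by
    cases x <;> cases y <;> cases z <;> simp [padd, oplus_assoc]

/-- The finite sum `⨁_{i ∈ s} f i` (`none` if undefined). -/
def oplusSum {ι : Type v} (f : ι → E) (s : Finset ι) : Option E :=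
  s.fold padd (some 0) fun i => some (f i)

/-- The multiple `n a = a ⊕ ⋯ ⊕ a` (`none` if undefined). -/
def mult : ℕ → E → Option E
  | 0, _ => some 0
  | n + 1, a => (mult n a).bind fun b => oplus b a

/-- The system `f` is `⊕`-orthogonal and `⨁ f` exists and equals `x`. -/
def HasBigSum {ι : Type v} (f : ι → E) (x : E) : Prop :=
  (∀ s : Finset ι, ∃ c, oplusSum f s = some c) ∧
    IsLUB {c | ∃ s : Finset ι, oplusSum f s = some c} x

/-- `ord a = n < ∞`: `n` is the greatest integer such that `n a` exists. -/
def HasOrd (a : E) (n : ℕ) : Prop :=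
  IsGreatest {m : ℕ | ∃ c, mult m a = some c} n

/-- A (finitely additive) state on an effect algebra. -/
structure IsState (ω : E → ℝ) : Prop where
  mem_Icc : ∀ x, ω x ∈ Set.Icc (0 : ℝ) 1
  map_one : ω 1 = 1
  map_oplus : ∀ x y z, oplus x y = some z → ω z = ω x + ω y

variable (E) in
/-- No nonzero element has all its multiples. -/
def IsArchimedean : Prop := ∀ e : E, e ≠ 0 → ∃ n : ℕ, mult n e = none

end Basic

section Order

/-- Order convergence of a net in a poset: `u_i ↑ a`, `v_i ↓ a` and `u_i ≤ x_i ≤ v_i`. -/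
def OrderConverges {P : Type u} [PartialOrder P] {Λ : Type v} [Preorder Λ]
    (x : Λ → P) (a : P) : Prop :=
  ∃ l r : Λ → P, Monotone l ∧ IsLUB (Set.range l) a ∧ Antitone r ∧ IsGLB (Set.range r) a ∧
    ∀ i, l i ≤ x i ∧ x i ≤ r i

/-- Order-continuity of a real function on a poset. -/
def IsOrderContinuous {P : Type u} [PartialOrder P] (ω : P → ℝ) : Prop :=
  ∀ (Λ : Type u) [Preorder Λ] [IsDirectedOrder Λ] [Nonempty Λ] (x : Λ → P) (a : P),
    OrderConverges x a → Filter.Tendsto (fun i => ω (x i)) Filter.atTop (nhds (ω a))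

end Order

section Sharp

variable {E : Type u} [LatticeEffectAlgebra E]

variable (E) in
/-- The set `S(E)` of sharp elements. -/
def sharp : Set E := {x | x ⊓ orth x = 0}

theorem eq_zero_of_le_zero {a : E} (h : a ≤ 0) : a = 0 := le_bot_iff.1 h

theorem le_orth_iff {a b : E} : a ≤ orth b ↔ ∃ c, oplus a b = some c := by
  constructor
  · intro h
    obtain ⟨c, hc⟩ := (le_iff _ _).1 h
    have h1 : oplus b (orth b) = some 1 := oplus_orth b
    obtain ⟨d, hd, -⟩ := assoc_left hc h1
    exact ⟨d, by rw [oplus_comm]; exact hd⟩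
  · rintro ⟨c, hc⟩
    rw [oplus_comm] at hc
    obtain ⟨f, hf, hf'⟩ := assoc_right hc (oplus_orth c)
    rw [← eq_orth hf']
    exact (le_iff _ _).2 ⟨_, hf⟩

theorem orth_le_orth {a b : E} (h : a ≤ b) : orth b ≤ orth a := by
  obtain ⟨c, hc⟩ := (le_iff _ _).1 h
  obtain ⟨f, hf, hf'⟩ := assoc_right hc (oplus_orth b)
  rw [← eq_orth hf', le_iff]
  exact ⟨c, by rw [oplus_comm]; exact hf⟩

theorem oplus_eq_sup {a b c : E} (h : oplus a b = some c) (h0 : a ⊓ b = 0) : c = a ⊔ b := by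
  have ha : a ≤ c := (le_iff _ _).2 ⟨b, h⟩
  have h' : oplus b a = some c := by rw [oplus_comm]; exact h
  have hb : b ≤ c := (le_iff _ _).2 ⟨a, h'⟩
  obtain ⟨d, hd⟩ := (le_iff _ _).1 (sup_le ha hb)
  have key : ∀ x y : E, oplus x y = some c → x ≤ a ⊔ b → d ≤ y := by
    intro x y hxy hx
    obtain ⟨e, he⟩ := (le_iff _ _).1 hx
    obtain ⟨f, hf, hf'⟩ := assoc_right he hd
    rw [oplus_left_cancel hxy hf', le_iff]
    exact ⟨e, by rw [oplus_comm]; exact hf⟩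
  have hd0 : d = 0 := eq_zero_of_le_zero (h0 ▸ le_inf (key b a h' le_sup_right) (key a b h le_sup_left))
  rw [hd0, oplus_zero, Option.some.injEq] at hd
  exact hd.symm

theorem orth_mem_sharp {a : E} (h : a ∈ sharp E) : orth a ∈ sharp E := by
  change orth a ⊓ orth (orth a) = 0
  rw [orth_orth, inf_comm]
  exact h

theorem one_mem_sharp : (1 : E) ∈ sharp E := by
  change (1 : E) ⊓ orth 1 = 0
  rw [← eq_orth one_oplus_zero]
  exact eq_zero_of_le_zero inf_le_right

theorem zero_mem_sharp : (0 : E) ∈ sharp E := by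
  rw [eq_orth (one_oplus_zero (E := E))]
  exact orth_mem_sharp one_mem_sharp

theorem oplus_mem_sharp {a b c : E} (ha : a ∈ sharp E) (hb : b ∈ sharp E)
    (h : oplus a b = some c) : c ∈ sharp E := by
  have hab : a ⊓ b = 0 := by
    have h1 : a ≤ orth b := le_orth_iff.2 ⟨c, h⟩
    have h2 : b ⊓ orth b = 0 := hb
    exact eq_zero_of_le_zero (h2 ▸ le_inf inf_le_right (inf_le_left.trans h1))
  have hc := oplus_eq_sup h hab
  have hwa : c ⊓ orth c ≤ orth a := inf_le_right.trans (orth_le_orth (hc ▸ le_sup_left))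
  have hwb : c ⊓ orth c ≤ orth b := inf_le_right.trans (orth_le_orth (hc ▸ le_sup_right))
  have hwc : c ⊓ orth c ≤ c := inf_le_left
  change c ⊓ orth c = 0
  generalize c ⊓ orth c = w at *
  obtain ⟨d, hd⟩ := le_orth_iff.1 hwa
  have ha' : a ⊓ orth a = 0 := ha
  have hwa0 : w ⊓ a = 0 := eq_zero_of_le_zero (ha' ▸ le_inf inf_le_right (inf_le_left.trans hwa))
  have hd' := oplus_eq_sup hd hwa0
  have hdc : d ≤ c := by rw [hd']; exact sup_le hwc (hc ▸ le_sup_left)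
  obtain ⟨e, he⟩ := (le_iff _ _).1 hdc
  rw [oplus_comm] at hd
  obtain ⟨f, hf, hf'⟩ := assoc_right hd he
  have hwb' : w ≤ b := by
    rw [oplus_left_cancel h hf', le_iff]
    exact ⟨e, hf⟩
  have hb' : b ⊓ orth b = 0 := hb
  exact eq_zero_of_le_zero (hb' ▸ le_inf hwb' hwb)

theorem sharp_of_oplus {a b c : E} (ha : a ∈ sharp E) (hc : c ∈ sharp E)
    (h : oplus a b = some c) : b ∈ sharp E := by
  rw [oplus_comm] at h
  obtain ⟨f, hf, hf'⟩ := assoc_right h (oplus_orth c)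
  rw [← orth_orth b, ← eq_orth hf']
  exact orth_mem_sharp (oplus_mem_sharp ha (orth_mem_sharp hc) hf)

/-- The operation of `E` restricted to `S(E)`. -/
def sharpOplus (x y : sharp E) : Option (sharp E) :=
  (oplus x.1 y.1).pmap (fun z hz => ⟨z, hz⟩) fun _ hz => oplus_mem_sharp x.2 y.2 hz

theorem sharpOplus_eq_some {x y z : sharp E} :
    sharpOplus x y = some z ↔ oplus x.1 y.1 = some z.1 := by
  simp [sharpOplus, Option.pmap_eq_some_iff, Subtype.ext_iff]

/-- `S(E)` with the inherited operation and order is an effect algebra. -/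
instance : EffectAlgebra (sharp E) where
  zero := ⟨0, zero_mem_sharp⟩
  one := ⟨1, one_mem_sharp⟩
  oplus := sharpOplus
  oplus_comm x y := by
    ext z
    rw [sharpOplus_eq_some, sharpOplus_eq_some, oplus_comm]
  oplus_assoc x y z := by
    ext w
    simp only [Option.bind_eq_some_iff, sharpOplus_eq_some]
    constructor
    · rintro ⟨d, hd, hw⟩
      obtain ⟨f, hf, hf'⟩ := assoc_right hd hw
      exact ⟨⟨f, oplus_mem_sharp y.2 z.2 hf⟩, hf, hf'⟩
    · rintro ⟨d, hd, hw⟩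
      obtain ⟨f, hf, hf'⟩ := assoc_left hd hw
      exact ⟨⟨f, oplus_mem_sharp x.2 y.2 hf⟩, hf, hf'⟩
  existsUnique_orth x := by
    refine ⟨⟨orth x.1, orth_mem_sharp x.2⟩, sharpOplus_eq_some.2 (oplus_orth x.1), ?_⟩
    intro y hy
    exact Subtype.ext (eq_orth (sharpOplus_eq_some.1 hy))
  eq_zero_of_one_oplus x c h :=
    Subtype.ext (eq_zero_of_one_oplus x.1 c.1 (sharpOplus_eq_some.1 h))
  le_iff x y := by
    rw [← Subtype.coe_le_coe, le_iff]
    constructor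
    · rintro ⟨c, hc⟩
      exact ⟨⟨c, sharp_of_oplus x.2 y.2 hc⟩, sharpOplus_eq_some.2 hc⟩
    · rintro ⟨c, hc⟩
      exact ⟨c.1, sharpOplus_eq_some.1 hc⟩

variable (E) in
/-- Every element has a smallest sharp element above it. -/
def IsSharplyDominating : Prop := ∀ a : E, ∃ b, IsLeast {b | b ∈ sharp E ∧ a ≤ b} b

/-- `x = v ⊕ ⨁ {k a · a | a ∈ A}` is a basic decomposition of `x`: `v` is sharp, `A` is a set of
atoms, and `k a ≠ ord a` is a positive integer for each `a ∈ A`. The set `A` and the integers are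
encoded together by the multiplicity function `k : E → ℕ`, with `A = {a | k a ≠ 0}`. -/
structure IsBasicDecomposition (x : E) (v : sharp E) (k : E → ℕ) : Prop where
  isAtom : ∀ a, k a ≠ 0 → IsAtom a
  not_hasOrd : ∀ a, k a ≠ 0 → ¬ HasOrd a (k a)
  eq_oplus : ∃ (t : {a : E // k a ≠ 0} → E) (s : E),
    (∀ a : {a : E // k a ≠ 0}, mult (k a.1) a.1 = some (t a)) ∧ HasBigSum t s ∧ oplus v.1 s = some x

end Sharp

end EffectAlgebra

/-!
Every `x` is a sum `⨁ k a · a` over a family of atoms, by Zorn's lemma. If `b` is an atom orthogonal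
to the other atoms of the family, then `x ⊕ b = x ∨ (k b + 1) b`. Hence an atom `b` of the family
with `k b ≠ ord b` is orthogonal to `x`, and so disjoint from every sharp element below `x`. It
follows that the terms with `k a = ord a` add up to the greatest sharp element `v` below `x`, and
the others to the rest of the basic decomposition of `x`. By order-continuity `ω v` is the sum of
the numbers `ω (n_a a)` over the former terms. Thus the smearing of `ω` at `x` is the sum of
`k a · ω (n_a a) / n_a` for *every* expression of `x` as `⨁ k a · a`, and additivity is clear.
-/

namespace EffectAlgebra

section PartialSums

variable {E : Type u} [EffectAlgebra E] {a b c : E} {x y z : WithTop E}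

/-- The partial operation of `E` becomes total on `WithTop E`, the element `⊤` being the value of
every undefined sum. -/
scoped instance : Add (WithTop E) := ⟨padd⟩

scoped instance : AddCommMonoid (WithTop E) where
  add_assoc := Std.Associative.assoc (op := padd (E := E))
  add_comm := Std.Commutative.comm (op := padd (E := E))
  zero_add
    | ⊤ => rfl
    | (a : E) => zero_oplus a
  add_zero
    | ⊤ => rfl
    | (a : E) => oplus_zero a
  nsmul := nsmulRec

theorem coe_add_coe_eq_coe : (a + b : WithTop E) = c ↔ oplus a b = some c := Iff.rfl

theorem top_add_eq_top (x : WithTop E) : ⊤ + x = ⊤ := rfl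

theorem add_top_eq_top (x : WithTop E) : x + ⊤ = ⊤ := by rw [add_comm, top_add_eq_top]

theorem add_eq_coe_iff : x + y = c ↔ ∃ a b : E, x = a ∧ y = b ∧ oplus a b = some c := by
  induction x with
  | top => simp [top_add_eq_top]
  | coe a => induction y with
    | top => simp [add_top_eq_top]
    | coe b => simp [coe_add_coe_eq_coe]

theorem nsmul_coe_eq_coe {n : ℕ} : n • (a : WithTop E) = c ↔ mult n a = some c := by
  induction n generalizing c with
  | zero => rw [zero_nsmul]; rfl
  | succ n ih => simp [succ_nsmul, add_eq_coe_iff, mult, Option.bind_eq_some_iff, ih]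

theorem coe_sum_eq_coe {ι : Type v} {f : ι → E} {s : Finset ι} :
    ∑ i ∈ s, (f i : WithTop E) = c ↔ oplusSum f s = some c := Iff.rfl

theorem le_add_right_self (x y : WithTop E) : x ≤ x + y := by
  refine WithTop.le_iff_forall.2 fun c hc => ?_
  obtain ⟨a, b, rfl, -, hab⟩ := add_eq_coe_iff.1 hc
  exact ⟨a, rfl, (le_iff a c).2 ⟨b, hab⟩⟩

scoped instance : CanonicallyOrderedAdd (WithTop E) where
  le_self_add := le_add_right_self
  le_add_self x y := add_comm x y ▸ le_add_right_self x y
  exists_add_of_le {x y} h := by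
    induction y with
    | top => exact ⟨⊤, (add_top_eq_top x).symm⟩
    | coe b =>
      lift x to E using ne_top_of_le_ne_top (WithTop.coe_ne_top) h
      obtain ⟨c, hc⟩ := (le_iff x b).1 (WithTop.coe_le_coe.1 h)
      exact ⟨c, (coe_add_coe_eq_coe.2 hc).symm⟩

scoped instance : IsOrderedAddMonoid (WithTop E) where
  add_le_add_left x y h z := by
    obtain ⟨w, rfl⟩ := exists_add_of_le h
    rw [add_right_comm]
    exact le_self_add

theorem eq_of_add_right_eq (h : x + z = y + z) (hz : y + z ≠ ⊤) : x = y := by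
  obtain ⟨d, hd⟩ := WithTop.ne_top_iff_exists.1 hz
  rw [← hd] at h
  obtain ⟨a, c, rfl, rfl, hac⟩ := add_eq_coe_iff.1 h
  obtain ⟨b, c', rfl, hc, hbc⟩ := add_eq_coe_iff.1 hd.symm
  cases WithTop.coe_injective hc
  rw [oplus_comm] at hac hbc
  rw [oplus_left_cancel hac hbc]

theorem le_of_add_right_le (h : x + z ≤ y + z) (hz : y + z ≠ ⊤) : x ≤ y := by
  obtain ⟨w, hw⟩ := exists_add_of_le h
  rw [add_right_comm] at hw
  rw [← eq_of_add_right_eq hw.symm hz]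
  exact le_self_add

theorem eq_zero_of_add_eq_left (h : x + y = x) (hx : x ≠ ⊤) : y = 0 := by
  refine eq_of_add_right_eq (z := x) ?_ ?_ <;> simpa [add_comm]

theorem isLUB_image_add_right {S : Set (WithTop E)} (hS : S.Nonempty) (hx : IsLUB S x)
    (z : WithTop E) : IsLUB ((· + z) '' S) (x + z) := by
  refine ⟨?_, fun u hu => ?_⟩
  · rintro _ ⟨s, hs, rfl⟩
    exact add_le_add_left (hx.1 hs) z
  · obtain rfl | hu_top := eq_or_ne u ⊤
    · exact le_top
    obtain ⟨s₀, hs₀⟩ := hS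
    obtain ⟨w, rfl⟩ := exists_add_of_le (le_add_self.trans (hu ⟨s₀, hs₀, rfl⟩))
    rw [add_comm z] at hu hu_top ⊢
    exact add_le_add_left (hx.2 fun s hs => le_of_add_right_le (hu ⟨s, hs, rfl⟩) hu_top) z

theorem isLUB_range_add {Λ : Type*} [Preorder Λ] [IsDirectedOrder Λ] [Nonempty Λ]
    {s t : Λ → WithTop E} (hs : Monotone s) (ht : Monotone t) (hx : IsLUB (Set.range s) x)
    (hy : IsLUB (Set.range t) y) : IsLUB (Set.range (s + t)) (x + y) := by
  refine ⟨?_, fun u hu => ?_⟩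
  · rintro _ ⟨i, rfl⟩
    exact add_le_add (hx.1 ⟨i, rfl⟩) (hy.1 ⟨i, rfl⟩)
  have hst (i j) : s i + t j ≤ u := by
    obtain ⟨k, hik, hjk⟩ := exists_ge_ge i j
    exact (add_le_add (hs hik) (ht hjk)).trans (hu ⟨k, rfl⟩)
  have hxt (j) : x + t j ≤ u := by
    refine (isLUB_image_add_right (Set.range_nonempty s) hx (t j)).2 ?_
    rintro _ ⟨_, ⟨i, rfl⟩, rfl⟩
    exact hst i j
  rw [add_comm]
  refine (isLUB_image_add_right (Set.range_nonempty t) hy x).2 ?_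
  rintro _ ⟨_, ⟨j, rfl⟩, rfl⟩
  exact (add_comm _ _).trans_le (hxt j)

/-- `x = ⨁ f`, the least upper bound of the finite partial sums of `f`. In contrast to
`HasBigSum`, undefined terms and sums are allowed: they have the value `⊤`. -/
def HasOplusSum {ι : Type*} (f : ι → WithTop E) (x : WithTop E) : Prop :=
  IsLUB (Set.range fun F : Finset ι => ∑ i ∈ F, f i) x

section HasOplusSum

variable {ι : Type*} {f g : ι → WithTop E}

theorem monotone_partialSum (f : ι → WithTop E) : Monotone fun F : Finset ι => ∑ i ∈ F, f i :=
  fun _ _ => Finset.sum_le_sum_of_subset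

theorem HasOplusSum.sum_le (hf : HasOplusSum f x) (F : Finset ι) : ∑ i ∈ F, f i ≤ x :=
  hf.1 ⟨F, rfl⟩

theorem HasOplusSum.add (hf : HasOplusSum f x) (hg : HasOplusSum g y) :
    HasOplusSum (f + g) (x + y) := by
  classical
  have hsum : (fun F : Finset ι => ∑ i ∈ F, (f + g) i) =
      (fun F => ∑ i ∈ F, f i) + fun F => ∑ i ∈ F, g i := funext fun _ => Finset.sum_add_distrib
  rw [HasOplusSum, hsum]
  exact isLUB_range_add (monotone_partialSum f) (monotone_partialSum g) hf hg

theorem hasOplusSum_single [DecidableEq ι] (i : ι) (x : WithTop E) :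
    HasOplusSum (Pi.single i x) x := by
  refine IsGreatest.isLUB ⟨⟨{i}, by simp⟩, ?_⟩
  rintro _ ⟨F, rfl⟩
  dsimp only
  rw [Finset.sum_pi_single']
  split_ifs
  exacts [le_rfl, zero_le]

theorem hasOplusSum_subtype {p : ι → Prop} (hp : ∀ i, f i ≠ 0 → p i) :
    HasOplusSum (fun i : {i // p i} => f i) x ↔ HasOplusSum f x := by
  classical
  have hrange : (Set.range fun F : Finset {i // p i} => ∑ i ∈ F, f i) =
      Set.range fun F : Finset ι => ∑ i ∈ F, f i := by
    ext c
    constructor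
    · rintro ⟨F, rfl⟩
      exact ⟨F.map (Function.Embedding.subtype p), Finset.sum_map ..⟩
    · rintro ⟨F, rfl⟩
      refine ⟨F.subtype p, ?_⟩
      dsimp only
      rw [Finset.sum_subtype_eq_sum_filter, Finset.sum_filter_of_ne fun i _ => hp i]
  rw [HasOplusSum, hrange, HasOplusSum]

theorem isLUB_image_withTopCoe {P : Type*} [Preorder P] {S : Set P} {p : P} :
    IsLUB ((↑) '' S : Set (WithTop P)) p ↔ IsLUB S p := by
  simp [isLUB_iff_le_iff, WithTop.forall, mem_upperBounds]

theorem hasBigSum_iff {ι : Type v} {f : ι → E} :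
    HasBigSum f a ↔ HasOplusSum (fun i => (f i : WithTop E)) a := by
  simp only [HasBigSum, ← coe_sum_eq_coe]
  have hrange (hdef : ∀ F : Finset ι, ∃ c : E, ∑ i ∈ F, (f i : WithTop E) = c) :
      (Set.range fun F : Finset ι => ∑ i ∈ F, (f i : WithTop E)) =
        (↑) '' {c : E | ∃ F : Finset ι, ∑ i ∈ F, (f i : WithTop E) = c} := by
    ext z
    constructor
    · rintro ⟨F, rfl⟩
      obtain ⟨c, hc⟩ := hdef F
      exact ⟨c, ⟨F, hc⟩, hc.symm⟩
    · rintro ⟨c, ⟨F, hF⟩, rfl⟩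
      exact ⟨F, hF⟩
  constructor
  · rintro ⟨hdef, hlub⟩
    rw [HasOplusSum, hrange hdef]
    exact isLUB_image_withTopCoe.2 hlub
  · intro h
    have hdef (F : Finset ι) : ∃ c : E, ∑ i ∈ F, (f i : WithTop E) = c := by
      obtain ⟨c, hc⟩ := WithTop.ne_top_iff_exists.1
        (ne_top_of_le_ne_top WithTop.coe_ne_top (h.sum_le F))
      exact ⟨c, hc.symm⟩
    rw [HasOplusSum, hrange hdef] at h
    exact ⟨hdef, isLUB_image_withTopCoe.1 h⟩

end HasOplusSum

theorem IsState.map_zero {ω : E → ℝ} (hω : IsState ω) : ω 0 = 0 := by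
  simpa using hω.map_oplus 0 0 0 (oplus_zero 0)

theorem IsState.map_sum {ω : E → ℝ} (hω : IsState ω) {ι : Type*} {f : ι → E} {F : Finset ι}
    (h : ∑ i ∈ F, (f i : WithTop E) = c) : ω c = ∑ i ∈ F, ω (f i) := by
  classical
  induction F using Finset.induction_on generalizing c with
  | empty => rw [← WithTop.coe_injective h, Finset.sum_empty]; exact hω.map_zero
  | insert i F hi ih =>
    rw [Finset.sum_insert hi] at h ⊢
    obtain ⟨a, b, ha, hb, hab⟩ := add_eq_coe_iff.1 h
    rw [hω.map_oplus a b c hab, ih hb, WithTop.coe_injective ha]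

end PartialSums

theorem IsOrderContinuous.tendsto_of_monotone {P : Type u} [PartialOrder P] {ω : P → ℝ}
    (hω : IsOrderContinuous ω) {Λ : Type u} [Preorder Λ] [IsDirectedOrder Λ] [Nonempty Λ]
    {x : Λ → P} {a : P} (hx : Monotone x) (ha : IsLUB (Set.range x) a) :
    Filter.Tendsto (fun i => ω (x i)) Filter.atTop (nhds (ω a)) :=
  hω Λ x a ⟨x, fun _ => a, hx, ha, antitone_const, by simp [Set.range_const],
    fun i => ⟨le_rfl, ha.1 ⟨i, rfl⟩⟩⟩

section OrthDisjoint

variable {E : Type u} [LatticeEffectAlgebra E] {a b : E} {x y z : WithTop E}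

theorem coe_add_coe_ne_top_iff : (a + b : WithTop E) ≠ ⊤ ↔ a ≤ orth b := by
  rw [le_orth_iff, WithTop.ne_top_iff_exists]
  exact exists_congr fun c => eq_comm

theorem sup_add (x y z : WithTop E) : (x ⊔ y) + z = (x + z) ⊔ (y + z) := by
  have h := isLUB_image_add_right (Set.insert_nonempty x {y}) isLUB_pair z
  rw [Set.image_pair] at h
  exact h.unique isLUB_pair

/-- The elements `x` whose sum with `z` is the join `z ⊔ x`. For `x z : E` this says that
`z ⊕ x` exists and `z ⊓ x = 0`. -/
def orthDisjoint (z : WithTop E) : AddSubmonoid (WithTop E) where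
  carrier := {x | z + x = z ⊔ x}
  zero_mem' := by
    change z + 0 = z ⊔ 0
    rw [add_zero, sup_of_le_left zero_le]
  add_mem' {x y} (hx : z + x = z ⊔ x) (hy : z + y = z ⊔ y) := by
    change z + (x + y) = z ⊔ (x + y)
    calc z + (x + y) = (z ⊔ x) + y := by rw [← add_assoc, hx]
      _ = z ⊔ (y ⊔ (x + y)) := by rw [sup_add, hy, sup_assoc]
      _ = z ⊔ (x + y) := by rw [sup_of_le_right le_add_self]

theorem mem_orthDisjoint : x ∈ orthDisjoint z ↔ z + x = z ⊔ x := Iff.rfl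

theorem mem_orthDisjoint_comm : x ∈ orthDisjoint z ↔ z ∈ orthDisjoint x := by
  rw [mem_orthDisjoint, mem_orthDisjoint, add_comm, sup_comm]

theorem coe_mem_orthDisjoint (h : (a + b : WithTop E) ≠ ⊤) (hab : Disjoint a b) :
    (b : WithTop E) ∈ orthDisjoint (a : WithTop E) := by
  obtain ⟨c, hc⟩ := WithTop.ne_top_iff_exists.1 h
  rw [mem_orthDisjoint, ← hc, oplus_eq_sup hc.symm (disjoint_iff.1 hab), WithTop.coe_sup]

theorem nsmul_mem_orthDisjoint_nsmul (h : y ∈ orthDisjoint x) (m n : ℕ) :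
    n • y ∈ orthDisjoint (m • x) :=
  nsmul_mem (mem_orthDisjoint_comm.1 (nsmul_mem (mem_orthDisjoint_comm.1 h) m)) n

theorem sup_ne_top (hx : x ≠ ⊤) (hy : y ≠ ⊤) : x ⊔ y ≠ ⊤ := by
  lift x to E using hx
  lift y to E using hy
  exact WithTop.coe_ne_top

variable {ι : Type*} {f g : ι → WithTop E}

theorem sum_eq_sup (hf : Pairwise fun i j => f j ∈ orthDisjoint (f i)) (F : Finset ι) :
    ∑ i ∈ F, f i = F.sup f := by
  classical
  induction F using Finset.induction_on with
  | empty => rfl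
  | insert i F hi ih =>
    have hmem : ∑ j ∈ F, f j ∈ orthDisjoint (f i) :=
      sum_mem fun j hj => hf (ne_of_mem_of_not_mem hj hi).symm
    rw [Finset.sum_insert hi, mem_orthDisjoint.1 hmem, ih, Finset.sup_insert]

theorem sum_ne_top (hf : Pairwise fun i j => f j ∈ orthDisjoint (f i)) (h : ∀ i, f i ≠ ⊤)
    (F : Finset ι) : ∑ i ∈ F, f i ≠ ⊤ := by
  rw [sum_eq_sup hf]
  exact Finset.sup_induction (p := (· ≠ ⊤)) WithTop.coe_ne_top
    (fun _ hx _ hy => sup_ne_top hx hy) fun i _ => h i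

theorem hasOplusSum_iff_isLUB (hf : Pairwise fun i j => f j ∈ orthDisjoint (f i)) :
    HasOplusSum f x ↔ IsLUB (Set.range f) x := by
  refine isLUB_congr ?_
  ext u
  simp only [sum_eq_sup hf, mem_upperBounds, Set.forall_mem_range, Finset.sup_le_iff]
  exact ⟨fun h i => h {i} i (Finset.mem_singleton_self i), fun h F i _ => h i⟩

theorem HasOplusSum.of_add (h : HasOplusSum (f + g) (x + y)) (hxy : x + y ≠ ⊤)
    (hf : ∀ F : Finset ι, ∑ i ∈ F, f i ≤ x) (hg : ∀ F : Finset ι, ∑ i ∈ F, g i ≤ y) :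
    HasOplusSum f x := by
  refine ⟨Set.forall_mem_range.2 hf, fun u hu => ?_⟩
  have hle : x + y ≤ (u ⊓ x) + y := by
    refine h.2 (Set.forall_mem_range.2 fun F => ?_)
    simp only [Pi.add_apply, Finset.sum_add_distrib]
    exact add_le_add (le_inf (hu ⟨F, rfl⟩) (hf F)) (hg F)
  have hxy' : (u ⊓ x) + y ≠ ⊤ := ne_top_of_le_ne_top hxy (add_le_add_left inf_le_right y)
  exact (le_of_add_right_le hle hxy').trans inf_le_left

end OrthDisjoint

section Ord

variable {E : Type u} [EffectAlgebra E] {a : E} {m n : ℕ}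

theorem nsmul_coe_ne_top_iff : n • (a : WithTop E) ≠ ⊤ ↔ ∃ c, mult n a = some c := by
  simp only [WithTop.ne_top_iff_exists, eq_comm, nsmul_coe_eq_coe]

theorem nsmul_ne_top_of_le {x : WithTop E} (h : m ≤ n) (hn : n • x ≠ ⊤) : m • x ≠ ⊤ :=
  ne_top_of_le_ne_top hn (nsmul_le_nsmul_left zero_le h)

theorem hasOrd_iff : HasOrd a n ↔ n • (a : WithTop E) ≠ ⊤ ∧ (n + 1) • (a : WithTop E) = ⊤ := by
  simp only [HasOrd, ← nsmul_coe_ne_top_iff]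
  refine ⟨fun h => ⟨h.1, not_not.1 fun hn => (h.2 hn).not_gt n.lt_succ_self⟩, fun h => ⟨h.1, ?_⟩⟩
  exact fun m hm => Nat.le_of_lt_succ (lt_of_not_ge fun hn => nsmul_ne_top_of_le hn hm h.2)

theorem HasOrd.pos (h : HasOrd a n) : 0 < n :=
  h.2 ⟨a, zero_oplus a⟩

theorem IsArchimedean.exists_hasOrd (hA : IsArchimedean E) (ha : a ≠ 0) : ∃ n, HasOrd a n := by
  obtain ⟨N, hN⟩ := hA a ha
  by_contra! hno
  have hdef (n : ℕ) : n • (a : WithTop E) ≠ ⊤ := by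
    induction n with
    | zero => exact (zero_nsmul (a : WithTop E)).trans_ne WithTop.coe_ne_top
    | succ n ih => exact fun htop => hno n (hasOrd_iff.2 ⟨ih, htop⟩)
  obtain ⟨c, hc⟩ := nsmul_coe_ne_top_iff.1 (hdef N)
  exact Option.some_ne_none c (hc.symm.trans hN)

/-- The order of `a`, with the junk value `0` when all multiples of `a` exist. -/
noncomputable def ord (a : E) : ℕ := sSup {n | ∃ c, mult n a = some c}

theorem HasOrd.ord_eq (h : HasOrd a n) : ord a = n := h.csSup_eq

end Ord

section Sharp

variable {E : Type u} [LatticeEffectAlgebra E] {a v w : E} {n : ℕ}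

/-- The inclusion of `S(E)` in `E` as a homomorphism of the monoids of partial sums. -/
def sharpInclusion : WithTop (sharp E) →+ WithTop E where
  toFun := WithTop.map (↑)
  map_zero' := rfl
  map_add'
    | ⊤, _ => rfl
    | (_ : sharp E), ⊤ => rfl
    | (v : sharp E), (w : sharp E) => by
      change (sharpOplus v w).map (↑) = oplus (v : E) w
      simp [sharpOplus, Option.map_pmap]

theorem exists_sum_sharp_eq {ι : Type*} {f : ι → sharp E} {F : Finset ι}
    (h : ∑ i ∈ F, ((f i : E) : WithTop E) ≠ ⊤) :
    ∃ c : sharp E, ∑ i ∈ F, (f i : WithTop (sharp E)) = c ∧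
      ∑ i ∈ F, ((f i : E) : WithTop E) = (c : E) := by
  have hmap : sharpInclusion (∑ i ∈ F, (f i : WithTop (sharp E))) =
      ∑ i ∈ F, ((f i : E) : WithTop E) := map_sum ..
  rw [← hmap] at h ⊢
  generalize ∑ i ∈ F, (f i : WithTop (sharp E)) = z at h ⊢
  induction z with
  | top => exact absurd rfl h
  | coe c => exact ⟨c, rfl, rfl⟩

theorem HasOrd.nsmul_mem_sharp (hn : HasOrd a n) (ha : IsAtom a)
    (hw : n • (a : WithTop E) = w) : w ∈ sharp E := by
  change w ⊓ orth w = 0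
  set b := w ⊓ orth w
  have hwb : (w + b : WithTop E) ≠ ⊤ := by
    rw [add_comm]
    exact coe_add_coe_ne_top_iff.2 inf_le_right
  have hab : ¬ a ≤ b := fun hab => by
    refine ne_top_of_le_ne_top hwb (add_le_add_right (WithTop.coe_le_coe.2 hab) _) ?_
    rw [← hw, ← succ_nsmul, (hasOrd_iff.1 hn).2]
  have haw : (a : WithTop E) ≤ w := by
    rw [← hw]
    simpa using nsmul_le_nsmul_left (zero_le (a := (a : WithTop E))) hn.pos
  have hadd : (a + b : WithTop E) ≠ ⊤ := ne_top_of_le_ne_top hwb (add_le_add_left haw _)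
  have hmem : (b : WithTop E) ∈ orthDisjoint (w : WithTop E) := by
    simpa [hw] using
      nsmul_mem_orthDisjoint_nsmul (coe_mem_orthDisjoint hadd (ha.not_le_iff_disjoint.1 hab)) n 1
  have hwb_eq : (w + b : WithTop E) = w := by
    rw [mem_orthDisjoint.1 hmem, sup_of_le_left (WithTop.coe_le_coe.2 inf_le_left)]
  exact WithTop.coe_injective (eq_zero_of_add_eq_left hwb_eq WithTop.coe_ne_top)

theorem nsmul_le_of_le_sharp (hv : v ∈ sharp E) (hav : a ≤ v) (hn : n • (a : WithTop E) ≠ ⊤) :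
    n • (a : WithTop E) ≤ v := by
  have hadd : (orth v + a : WithTop E) ≠ ⊤ := by
    rw [add_comm, coe_add_coe_ne_top_iff, orth_orth]
    exact hav
  have hdisj : Disjoint (orth v) a := (disjoint_iff.2 hv).symm.mono_right hav
  have hmem : n • (a : WithTop E) ∈ orthDisjoint ((orth v : E) : WithTop E) :=
    nsmul_mem (coe_mem_orthDisjoint hadd hdisj) n
  obtain ⟨c, hc⟩ := WithTop.ne_top_iff_exists.1 hn
  rw [← hc, WithTop.coe_le_coe, ← orth_orth v, ← coe_add_coe_ne_top_iff, add_comm, hc,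
    mem_orthDisjoint.1 hmem, ← hc, ← WithTop.coe_sup]
  exact WithTop.coe_ne_top

theorem IsSharplyDominating.exists_isGreatest (hS : IsSharplyDominating E) (x : E) :
    ∃ v : sharp E, IsGreatest {v : sharp E | (v : E) ≤ x} v := by
  obtain ⟨b, ⟨hb, hxb⟩, hleast⟩ := hS (orth x)
  have hbx : orth b ≤ x := orth_orth x ▸ orth_le_orth hxb
  refine ⟨⟨orth b, orth_mem_sharp hb⟩, hbx, fun v hv => Subtype.coe_le_coe.1 ?_⟩
  rw [← orth_orth (v : E)]
  exact orth_le_orth (hleast ⟨orth_mem_sharp v.2, orth_le_orth hv⟩)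

end Sharp

section AtomicSum

variable {E : Type u} [LatticeEffectAlgebra E] {a b x y z : E} {k l : E → ℕ}

/-- `x = ⨁ {k a · a | k a ≠ 0}`, all `a` with `k a ≠ 0` being atoms. -/
structure IsAtomicSum (k : E → ℕ) (x : E) : Prop where
  isAtom : ∀ a, k a ≠ 0 → IsAtom a
  hasOplusSum : HasOplusSum (fun a => k a • (a : WithTop E)) x

theorem add_nsmul_coe (k l : E → ℕ) : (fun a => (k + l) a • (a : WithTop E)) =
    (fun a => k a • (a : WithTop E)) + fun a => l a • (a : WithTop E) :=
  funext fun _ => add_nsmul ..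

theorem coe_le_nsmul_coe {n : ℕ} (hn : n ≠ 0) : (a : WithTop E) ≤ n • a := by
  simpa using nsmul_le_nsmul_left (zero_le (a := (a : WithTop E))) (Nat.one_le_iff_ne_zero.2 hn)

theorem pairwise_nsmul_mem_orthDisjoint (hk : ∀ a, k a ≠ 0 → IsAtom a)
    (horth : ∀ a b, a ≠ b → k a ≠ 0 → k b ≠ 0 → (a + b : WithTop E) ≠ ⊤) :
    Pairwise fun a b => k b • (b : WithTop E) ∈ orthDisjoint (k a • (a : WithTop E)) := by
  intro a b hab
  by_cases ha : k a = 0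
  · rw [mem_orthDisjoint_comm, ha, zero_nsmul]
    exact zero_mem _
  by_cases hb : k b = 0
  · rw [hb, zero_nsmul]
    exact zero_mem _
  · exact nsmul_mem_orthDisjoint_nsmul
      (coe_mem_orthDisjoint (horth a b hab ha hb) ((hk a ha).disjoint_of_ne (hk b hb) hab)) _ _

namespace IsAtomicSum

theorem add (hk : IsAtomicSum k x) (hl : IsAtomicSum l y) (hxy : (x + y : WithTop E) = z) :
    IsAtomicSum (k + l) z where
  isAtom a ha := by
    by_cases hka : k a = 0
    · exact hl.isAtom a fun hla => ha (by simp [hka, hla])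
    · exact hk.isAtom a hka
  hasOplusSum := by
    rw [add_nsmul_coe, ← hxy]
    exact hk.hasOplusSum.add hl.hasOplusSum

theorem single [DecidableEq E] (ha : IsAtom a) : IsAtomicSum (Pi.single a 1) a where
  isAtom b hb := by
    obtain rfl : b = a := by_contra fun hba => hb (Pi.single_eq_of_ne hba 1)
    exact ha
  hasOplusSum := by
    convert hasOplusSum_single a (a : WithTop E) using 1
    ext b
    obtain rfl | hba := eq_or_ne b a
    · simp
    · simp [hba]

theorem nsmul_le (hk : IsAtomicSum k x) (a : E) : k a • (a : WithTop E) ≤ x := by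
  simpa using hk.hasOplusSum.sum_le {a}

theorem coe_add_coe_ne_top (hk : IsAtomicSum k x) (hab : a ≠ b) (ha : k a ≠ 0) (hb : k b ≠ 0) :
    (a + b : WithTop E) ≠ ⊤ := by
  classical
  have hle : k a • (a : WithTop E) + k b • (b : WithTop E) ≤ x := by
    simpa [Finset.sum_pair hab] using hk.hasOplusSum.sum_le {a, b}
  exact ne_top_of_le_ne_top WithTop.coe_ne_top
    ((add_le_add (coe_le_nsmul_coe ha) (coe_le_nsmul_coe hb)).trans hle)

theorem add_atom_eq_sup (hk : IsAtomicSum k x) (hb : IsAtom b)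
    (horth : ∀ a, a ≠ b → k a ≠ 0 → (a + b : WithTop E) ≠ ⊤) :
    (x + b : WithTop E) = (x : WithTop E) ⊔ (k b + 1) • (b : WithTop E) := by
  classical
  set l : E → ℕ := k + Pi.single b 1
  have hl : l b = k b + 1 := by simp [l]
  have hl_ne {a : E} (hab : a ≠ b) : l a = k a := by simp [l, hab]
  have hatom (a : E) (ha : l a ≠ 0) : IsAtom a := by
    obtain rfl | hab := eq_or_ne a b
    exacts [hb, hk.isAtom a (hl_ne hab ▸ ha)]
  have hpair : Pairwise fun a c =>
      l c • (c : WithTop E) ∈ orthDisjoint (l a • (a : WithTop E)) := by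
    refine pairwise_nsmul_mem_orthDisjoint hatom fun a c hac ha hc => ?_
    obtain rfl | hab := eq_or_ne a b
    · rw [add_comm]
      exact horth c hac.symm (hl_ne hac.symm ▸ hc)
    obtain rfl | hcb := eq_or_ne c b
    · exact horth a hab (hl_ne hab ▸ ha)
    · exact hk.coe_add_coe_ne_top hac (hl_ne hab ▸ ha) (hl_ne hcb ▸ hc)
  have hsum : HasOplusSum (fun a => l a • (a : WithTop E)) (x + b) := by
    rw [add_nsmul_coe]
    exact hk.hasOplusSum.add (single hb).hasOplusSum
  have hlub := (hasOplusSum_iff_isLUB hpair).1 hsum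
  rw [← hl]
  refine le_antisymm (hlub.2 (Set.forall_mem_range.2 fun a => ?_))
    (sup_le le_self_add (hlub.1 ⟨b, rfl⟩))
  obtain rfl | hab := eq_or_ne a b
  · exact le_sup_right
  · rw [hl_ne hab]
    exact le_sup_of_le_left (hk.nsmul_le a)

theorem not_succ_nsmul_le (hk : IsAtomicSum k x) (hb : IsAtom b)
    (horth : ∀ a, a ≠ b → k a ≠ 0 → (a + b : WithTop E) ≠ ⊤) :
    ¬ (k b + 1) • (b : WithTop E) ≤ x := fun hle => by
  have hadd : (x + b : WithTop E) = x := by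
    rw [hk.add_atom_eq_sup hb horth, sup_of_le_left hle]
  exact hb.1 (WithTop.coe_injective (eq_zero_of_add_eq_left hadd WithTop.coe_ne_top))

theorem hasOrd_of_add_eq_top (hk : IsAtomicSum k x) (hb : k b ≠ 0)
    (htop : (x + b : WithTop E) = ⊤) : HasOrd b (k b) := by
  refine hasOrd_iff.2 ⟨ne_top_of_le_ne_top WithTop.coe_ne_top (hk.nsmul_le b), ?_⟩
  rw [hk.add_atom_eq_sup (hk.isAtom b hb) fun a hab ha => hk.coe_add_coe_ne_top hab ha hb] at htop
  exact by_contra fun hne => sup_ne_top WithTop.coe_ne_top hne htop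

theorem not_succ_nsmul_le_of_forall_not_hasOrd (hk : IsAtomicSum k x)
    (hord : ∀ a, k a ≠ 0 → ¬ HasOrd a (k a)) (hb : IsAtom b) :
    ¬ (k b + 1) • (b : WithTop E) ≤ x := fun hle => by
  refine hk.not_succ_nsmul_le hb (fun a _ ha => ?_) hle
  rw [add_comm]
  refine ne_top_of_le_ne_top (fun htop => hord a ha (hk.hasOrd_of_add_eq_top ha htop))
    (add_le_add_left ((coe_le_nsmul_coe (k b).succ_ne_zero).trans hle) _)

theorem le_of_forall_not_hasOrd (hk : IsAtomicSum k x) (hl : IsAtomicSum l x)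
    (hord : ∀ a, l a ≠ 0 → ¬ HasOrd a (l a)) : k ≤ l := fun a => by
  by_contra! hlt
  have ha : IsAtom a := hk.isAtom a (Nat.ne_zero_of_lt hlt)
  exact hl.not_succ_nsmul_le_of_forall_not_hasOrd hord ha
    ((nsmul_le_nsmul_left zero_le hlt).trans (hk.nsmul_le a))

theorem eq_zero_of_sharp_le [IsAtomic E] (hA : IsArchimedean E) (hk : IsAtomicSum k x)
    (hord : ∀ a, k a ≠ 0 → ¬ HasOrd a (k a)) {s : E} (hs : s ∈ sharp E) (hsx : s ≤ x) : s = 0 := by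
  obtain rfl | ⟨a, ha, has⟩ := eq_bot_or_exists_atom_le s
  · rfl
  obtain ⟨n, hn⟩ := hA.exists_hasOrd ha.1
  have hna : n • (a : WithTop E) ≤ x :=
    (nsmul_le_of_le_sharp hs has (hasOrd_iff.1 hn).1).trans (WithTop.coe_le_coe.2 hsx)
  have hka : k a < n := by
    obtain h0 | h0 := eq_or_ne (k a) 0
    · exact h0 ▸ hn.pos
    have hle : k a ≤ n := hn.2 <| nsmul_coe_ne_top_iff.1 <|
      ne_top_of_le_ne_top WithTop.coe_ne_top (hk.nsmul_le a)
    exact hle.lt_of_ne fun h => hord a h0 (h ▸ hn)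
  exact absurd ((nsmul_le_nsmul_left zero_le hka).trans hna)
    (hk.not_succ_nsmul_le_of_forall_not_hasOrd hord ha)

end IsAtomicSum

theorem exists_upperBound_eq_on_finset {α : Type*} {c : Set (α → ℕ)} (hc : IsChain (· ≤ ·) c)
    (hne : c.Nonempty) (hbdd : BddAbove c) :
    ∃ u ∈ upperBounds c, ∀ F : Finset α, ∃ k ∈ c, ∀ a ∈ F, k a = u a := by
  classical
  have hattained (a : α) : ∃ k : c, ∀ l : c, l.1 a ≤ k.1 a := by
    obtain ⟨B, hB⟩ := hbdd
    have hbdd_a : BddAbove ((fun k => k a) '' c) :=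
      ⟨B a, Set.forall_mem_image.2 fun k hk => hB hk a⟩
    obtain ⟨k, hk, hka⟩ := Nat.sSup_mem (hne.image _) hbdd_a
    exact ⟨⟨k, hk⟩, fun l => (le_csSup hbdd_a ⟨l, l.2, rfl⟩).trans_eq hka.symm⟩
  choose K hK using hattained
  refine ⟨fun a => (K a).1 a, fun l hl a => hK a ⟨l, hl⟩, fun F => ?_⟩
  have : Nonempty c := hne.to_subtype
  obtain ⟨k, hk⟩ := (directedOn_iff_directed.1 hc.directedOn).finset_le (F.image K)
  exact ⟨k, k.2, fun a ha => (hK a k).antisymm (hk _ (Finset.mem_image_of_mem K ha) a)⟩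

/-- The multiplicity functions of families of atoms whose finite sums exist and lie below `x`. The
maximal ones are those with sum `x`. -/
def atomicSubsums (x : E) : Set (E → ℕ) :=
  {k | (∀ a, k a ≠ 0 → IsAtom a) ∧ ∀ F : Finset E, ∑ a ∈ F, k a • (a : WithTop E) ≤ x}

theorem bddAbove_atomicSubsums (hA : IsArchimedean E) (x : E) : BddAbove (atomicSubsums x) := by
  refine ⟨ord, fun k hk a => ?_⟩
  by_cases hka : k a = 0
  · rw [hka]
    exact Nat.zero_le _
  obtain ⟨n, hn⟩ := hA.exists_hasOrd (hk.1 a hka).1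
  have hle : k a • (a : WithTop E) ≤ x := by simpa using hk.2 {a}
  rw [hn.ord_eq]
  exact hn.2 (nsmul_coe_ne_top_iff.1 (ne_top_of_le_ne_top WithTop.coe_ne_top hle))

theorem exists_upperBound_mem_atomicSubsums (hA : IsArchimedean E) {c : Set (E → ℕ)}
    (hcx : c ⊆ atomicSubsums x) (hc : IsChain (· ≤ ·) c) (hne : c.Nonempty) :
    ∃ u ∈ atomicSubsums x, ∀ k ∈ c, k ≤ u := by
  obtain ⟨u, hu, hfin⟩ :=
    exists_upperBound_eq_on_finset hc hne ((bddAbove_atomicSubsums hA x).mono hcx)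
  refine ⟨u, ⟨fun a ha => ?_, fun F => ?_⟩, hu⟩
  · obtain ⟨k, hk, hku⟩ := hfin {a}
    exact (hcx hk).1 a (hku a (Finset.mem_singleton_self a) ▸ ha)
  · obtain ⟨k, hk, hku⟩ := hfin F
    calc ∑ a ∈ F, u a • (a : WithTop E) = ∑ a ∈ F, k a • (a : WithTop E) :=
          Finset.sum_congr rfl fun a ha => by rw [hku a ha]
      _ ≤ x := (hcx hk).2 F

theorem isAtomicSum_of_maximal [IsAtomic E] (hk : Maximal (· ∈ atomicSubsums x) k) :
    IsAtomicSum k x := by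
  classical
  refine ⟨hk.prop.1, Set.forall_mem_range.2 hk.prop.2, fun u hu => ?_⟩
  obtain ⟨w, hw⟩ := exists_add_of_le (inf_le_right : u ⊓ x ≤ x)
  obtain ⟨-, w, -, rfl, -⟩ := add_eq_coe_iff.1 hw.symm
  obtain rfl | ⟨b, hb, hbw⟩ := eq_bot_or_exists_atom_le w
  · exact (hw.trans (add_zero _)).trans_le inf_le_left
  have hmem : k + Pi.single b 1 ∈ atomicSubsums x := by
    refine ⟨fun a ha => ?_, fun F => ?_⟩
    · obtain rfl | hab := eq_or_ne a b
      exacts [hb, hk.prop.1 a (by simpa [hab] using ha)]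
    · simp only [Pi.add_apply, add_nsmul, Finset.sum_add_distrib]
      calc (∑ a ∈ F, k a • (a : WithTop E)) + ∑ a ∈ F, Pi.single b 1 a • (a : WithTop E)
          ≤ (u ⊓ x) + b :=
            add_le_add (le_inf (hu ⟨F, rfl⟩) (hk.prop.2 F))
              ((IsAtomicSum.single hb).hasOplusSum.sum_le F)
        _ ≤ (u ⊓ x) + w := add_le_add_right (WithTop.coe_le_coe.2 hbw) _
        _ = x := hw.symm
  simpa using hk.le_of_ge hmem (le_add_of_nonneg_right (Pi.single_nonneg.2 zero_le_one)) b

theorem exists_isAtomicSum [IsAtomic E] (hA : IsArchimedean E) (x : E) :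
    ∃ k, IsAtomicSum k x := by
  obtain ⟨k, -, hk⟩ := zorn_le_nonempty₀ (atomicSubsums x)
    (fun c hcx hc k hk => exists_upperBound_mem_atomicSubsums hA hcx hc ⟨k, hk⟩) 0
    ⟨fun a ha => absurd rfl ha, fun F => by simp⟩
  exact ⟨k, isAtomicSum_of_maximal hk⟩

end AtomicSum

section BasicDecomposition

variable {E : Type u} [LatticeEffectAlgebra E] {x s : E} {v : sharp E} {h k l : E → ℕ}

theorem isBasicDecomposition_iff : IsBasicDecomposition x v k ↔
    (∀ a, k a ≠ 0 → ¬ HasOrd a (k a)) ∧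
      ∃ s, IsAtomicSum k s ∧ ((v : E) + s : WithTop E) = x := by
  have hsub {t : {a : E // k a ≠ 0} → E} (ht : ∀ a, mult (k a.1) a.1 = some (t a)) {s : E} :
      HasBigSum t s ↔ HasOplusSum (fun a => k a • (a : WithTop E)) s := by
    simp only [hasBigSum_iff, ← nsmul_coe_eq_coe.2 (ht _)]
    exact hasOplusSum_subtype (f := fun a => k a • (a : WithTop E)) fun a ha hka =>
      ha (by rw [hka, zero_nsmul])
  constructor
  · rintro ⟨hatom, hord, t, s, ht, hts, hvs⟩
    exact ⟨hord, s, ⟨hatom, (hsub ht).1 hts⟩, hvs⟩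
  · rintro ⟨hord, s, hk, hvs⟩
    have hdef (a : {a : E // k a ≠ 0}) : ∃ c, mult (k a) a.1 = some c :=
      nsmul_coe_ne_top_iff.1 (ne_top_of_le_ne_top WithTop.coe_ne_top (hk.nsmul_le a))
    choose t ht using hdef
    exact ⟨hk.isAtom, hord, t, s, ht, (hsub ht).2 hk.hasOplusSum, hvs⟩

theorem isBasicDecomposition_sharp (v : sharp E) : IsBasicDecomposition (v : E) v 0 := by
  refine isBasicDecomposition_iff.2 ⟨fun a ha => absurd rfl ha, 0, ⟨fun a ha => absurd rfl ha, ?_⟩,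
    add_zero _⟩
  simp [HasOplusSum]

theorem exists_nsmul_eq_sharp (hatom : ∀ a, l a ≠ 0 → IsAtom a)
    (hord : ∀ a, l a ≠ 0 → HasOrd a (l a)) :
    ∃ w : E → sharp E, ∀ a, l a • (a : WithTop E) = (w a : E) := by
  have hex (a : E) : ∃ w : sharp E, l a • (a : WithTop E) = (w : E) := by
    by_cases ha : l a = 0
    · exact ⟨0, by rw [ha, zero_nsmul]; rfl⟩
    obtain ⟨w, hw⟩ := WithTop.ne_top_iff_exists.1 (hasOrd_iff.1 (hord a ha)).1
    exact ⟨⟨w, (hord a ha).nsmul_mem_sharp (hatom a ha) hw.symm⟩, hw.symm⟩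
  exact Classical.skolem.1 hex

/-- The terms `h a · a` with `h a = ord a` of the sum `⨁ h a · a`. -/
noncomputable def sharpPart (h : E → ℕ) : E → ℕ := {a | HasOrd a (h a)}.indicator h

/-- The terms `h a · a` with `h a ≠ ord a` of the sum `⨁ h a · a`. -/
noncomputable def unsharpPart (h : E → ℕ) : E → ℕ := {a | HasOrd a (h a)}ᶜ.indicator h

theorem sharpPart_add_unsharpPart (h : E → ℕ) : sharpPart h + unsharpPart h = h :=
  Set.indicator_self_add_compl _ h

theorem hasOrd_sharpPart {a : E} (ha : sharpPart h a ≠ 0) : HasOrd a (sharpPart h a) := by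
  have hmem : HasOrd a (h a) := Set.mem_of_indicator_ne_zero (s := {a | HasOrd a (h a)}) ha
  rwa [sharpPart, Set.indicator_of_mem (s := {a | HasOrd a (h a)}) hmem]

theorem not_hasOrd_unsharpPart {a : E} (ha : unsharpPart h a ≠ 0) :
    ¬ HasOrd a (unsharpPart h a) := by
  have hmem : ¬ HasOrd a (h a) := Set.mem_of_indicator_ne_zero ha
  rwa [unsharpPart, Set.indicator_of_mem (s := {a | HasOrd a (h a)}ᶜ) hmem]

theorem sharpPart_le (h : E → ℕ) : sharpPart h ≤ h := Set.indicator_le_self _ h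

theorem unsharpPart_le (h : E → ℕ) : unsharpPart h ≤ h := Set.indicator_le_self _ h

namespace IsAtomicSum

theorem isAtom_of_le (hh : IsAtomicSum h x) (hlh : l ≤ h) {a : E} (ha : l a ≠ 0) : IsAtom a :=
  hh.isAtom a (ne_of_gt ((Nat.pos_of_ne_zero ha).trans_le (hlh a)))

theorem sum_nsmul_le (hh : IsAtomicSum h x) (hlh : l ≤ h) (F : Finset E) :
    ∑ a ∈ F, l a • (a : WithTop E) ≤ x :=
  (Finset.sum_le_sum fun a _ => nsmul_le_nsmul_left zero_le (hlh a)).trans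
    (hh.hasOplusSum.sum_le F)

theorem sum_sharpPart_le (hh : IsAtomicSum h x)
    (hv : IsGreatest {v : sharp E | (v : E) ≤ x} v) (F : Finset E) :
    ∑ a ∈ F, sharpPart h a • (a : WithTop E) ≤ (v : E) := by
  obtain ⟨w, hw⟩ := exists_nsmul_eq_sharp
    (fun a => hh.isAtom_of_le (sharpPart_le h)) (fun a => hasOrd_sharpPart (h := h))
  have hle := hh.sum_nsmul_le (sharpPart_le h) F
  simp only [hw] at hle ⊢
  obtain ⟨c, -, hc⟩ := exists_sum_sharp_eq (ne_top_of_le_ne_top WithTop.coe_ne_top hle)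
  rw [hc] at hle ⊢
  exact WithTop.coe_le_coe.2 (hv.2 (WithTop.coe_le_coe.1 hle))

theorem sum_unsharpPart_le (hh : IsAtomicSum h x) (hvs : ((v : E) + s : WithTop E) = x)
    (F : Finset E) : ∑ a ∈ F, unsharpPart h a • (a : WithTop E) ≤ s := by
  have hv : (v : E) ≤ x := (le_iff _ _).2 ⟨s, hvs⟩
  have hmem : ∑ a ∈ F, unsharpPart h a • (a : WithTop E) ∈
      orthDisjoint ((v : E) : WithTop E) := by
    refine sum_mem fun a _ => ?_
    obtain h0 | h0 := eq_or_ne (unsharpPart h a) 0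
    · rw [h0, zero_nsmul]
      exact zero_mem _
    have ha : ¬ HasOrd a (h a) := Set.mem_of_indicator_ne_zero h0
    have hxa : (x + a : WithTop E) ≠ ⊤ := fun htop =>
      ha (hh.hasOrd_of_add_eq_top
        (ne_of_gt ((Nat.pos_of_ne_zero h0).trans_le (unsharpPart_le h a))) htop)
    have hva : ((v : E) + a : WithTop E) ≠ ⊤ :=
      ne_top_of_le_ne_top hxa (add_le_add_left (WithTop.coe_le_coe.2 hv) _)
    have hdisj : Disjoint (v : E) a := by
      rw [add_comm, coe_add_coe_ne_top_iff] at hva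
      exact (disjoint_iff.2 v.2).mono_right hva
    exact nsmul_mem (coe_mem_orthDisjoint hva hdisj) _
  have hle : ((v : E) : WithTop E) + ∑ a ∈ F, unsharpPart h a • (a : WithTop E) ≤
      (v : E) + s := by
    rw [mem_orthDisjoint.1 hmem, hvs]
    exact sup_le (WithTop.coe_le_coe.2 hv) (hh.sum_nsmul_le (unsharpPart_le h) F)
  rw [add_comm, add_comm _ (s : WithTop E)] at hle
  exact le_of_add_right_le hle (by rw [add_comm, hvs]; exact WithTop.coe_ne_top)

theorem isAtomicSum_sharpPart (hh : IsAtomicSum h x)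
    (hv : IsGreatest {v : sharp E | (v : E) ≤ x} v) (hvs : ((v : E) + s : WithTop E) = x) :
    IsAtomicSum (sharpPart h) v where
  isAtom a ha := hh.isAtom_of_le (sharpPart_le h) ha
  hasOplusSum := by
    have hsum := hh.hasOplusSum
    rw [← sharpPart_add_unsharpPart h, add_nsmul_coe, ← hvs] at hsum
    exact hsum.of_add (hvs ▸ WithTop.coe_ne_top) (hh.sum_sharpPart_le hv)
      (hh.sum_unsharpPart_le hvs)

theorem isAtomicSum_unsharpPart (hh : IsAtomicSum h x)
    (hv : IsGreatest {v : sharp E | (v : E) ≤ x} v) (hvs : ((v : E) + s : WithTop E) = x) :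
    IsAtomicSum (unsharpPart h) s where
  isAtom a ha := hh.isAtom_of_le (unsharpPart_le h) ha
  hasOplusSum := by
    have hsum := hh.hasOplusSum
    rw [← sharpPart_add_unsharpPart h, add_comm, add_nsmul_coe, ← hvs, add_comm _ (s : WithTop E)]
      at hsum
    exact hsum.of_add (by rw [add_comm, hvs]; exact WithTop.coe_ne_top)
      (hh.sum_unsharpPart_le hvs) (hh.sum_sharpPart_le hv)

end IsAtomicSum

theorem IsAtomicSum.exists_isBasicDecomposition (hS : IsSharplyDominating E)
    (hh : IsAtomicSum h x) :
    ∃ v : sharp E, IsAtomicSum (sharpPart h) v ∧ IsBasicDecomposition x v (unsharpPart h) := by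
  obtain ⟨v, hv⟩ := hS.exists_isGreatest x
  obtain ⟨s, hvs⟩ := (le_iff _ _).1 hv.1
  exact ⟨v, hh.isAtomicSum_sharpPart hv hvs, isBasicDecomposition_iff.2
    ⟨fun _ => not_hasOrd_unsharpPart, s, hh.isAtomicSum_unsharpPart hv hvs, hvs⟩⟩

theorem IsBasicDecomposition.isGreatest [IsAtomic E] (hA : IsArchimedean E)
    (hS : IsSharplyDominating E) (hd : IsBasicDecomposition x v k) :
    IsGreatest {v : sharp E | (v : E) ≤ x} v := by
  obtain ⟨hord, s, hk, hvs⟩ := isBasicDecomposition_iff.1 hd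
  obtain ⟨w, hw⟩ := hS.exists_isGreatest x
  obtain ⟨d, hvd⟩ := (le_iff v w).1 (hw.2 ((le_iff _ _).2 ⟨s, hvs⟩))
  obtain ⟨e, hwe⟩ := (le_iff _ _).1 hw.1
  obtain ⟨f, hde, hvf⟩ := assoc_right (sharpOplus_eq_some.1 hvd) hwe
  cases oplus_left_cancel hvf hvs
  have hd0 : d = 0 := Subtype.ext (hk.eq_zero_of_sharp_le hA hord d.2 ((le_iff _ _).2 ⟨e, hde⟩))
  rw [hd0, oplus_zero, Option.some.injEq] at hvd
  exact hvd ▸ hw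

theorem existsUnique_isBasicDecomposition [IsAtomic E] (hA : IsArchimedean E)
    (hS : IsSharplyDominating E) (x : E) :
    ∃! d : sharp E × (E → ℕ), IsBasicDecomposition x d.1 d.2 := by
  obtain ⟨h, hh⟩ := exists_isAtomicSum hA x
  obtain ⟨v, -, hd⟩ := hh.exists_isBasicDecomposition hS
  refine ⟨(v, unsharpPart h), hd, ?_⟩
  rintro ⟨w, l⟩ (hd' : IsBasicDecomposition x w l)
  obtain rfl : w = v := (hd'.isGreatest hA hS).unique (hd.isGreatest hA hS)
  obtain ⟨hord, s, hk, hs⟩ := isBasicDecomposition_iff.1 hd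
  obtain ⟨hord', t, hl, ht⟩ := isBasicDecomposition_iff.1 hd'
  cases oplus_left_cancel hs ht
  exact Prod.ext rfl
    ((hl.le_of_forall_not_hasOrd hk hord).antisymm (hk.le_of_forall_not_hasOrd hl hord'))

end BasicDecomposition

section Smearing

variable {E : Type u} [LatticeEffectAlgebra E] {ω : sharp E → ℝ} {a x : E} {v : sharp E}
  {h k l : E → ℕ} {n : ℕ}

/-- The value `ω (n_a a) / n_a` that a smearing of `ω` takes at an atom `a`, where `n_a = ord a`. -/
noncomputable def atomWeight (ω : sharp E → ℝ) (a : E) : ℝ :=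
  Function.extend (fun w : sharp E => some (w : E)) ω 0 (mult (ord a) a) / ord a

theorem some_coe_sharp_injective : Function.Injective fun w : sharp E => some (w : E) :=
  (Option.some_injective E).comp Subtype.coe_injective

theorem HasOrd.atomWeight_eq (hn : HasOrd a n) (hw : mult n a = some (v : E)) :
    atomWeight ω a = ω v / n := by
  rw [atomWeight, hn.ord_eq, hw, some_coe_sharp_injective.extend_apply]

theorem atomWeight_nonneg (hω : IsState ω) (a : E) : 0 ≤ atomWeight ω a := by
  refine div_nonneg ?_ (Nat.cast_nonneg _)
  by_cases hex : ∃ w : sharp E, some (w : E) = mult (ord a) a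
  · obtain ⟨w, hw⟩ := hex
    rw [← hw, some_coe_sharp_injective.extend_apply]
    exact (hω.mem_Icc w).1
  · rw [Function.extend_apply' _ _ _ hex, Pi.zero_apply]

theorem map_eq_mul_atomWeight (hω : IsState ω) (hord : l a ≠ 0 → HasOrd a (l a))
    (hv : l a • (a : WithTop E) = (v : E)) : ω v = l a * atomWeight ω a := by
  obtain h0 | h0 := eq_or_ne (l a) 0
  · rw [h0, zero_nsmul] at hv
    obtain rfl : 0 = v := Subtype.ext (WithTop.coe_injective hv)
    rw [hω.map_zero, h0, Nat.cast_zero, zero_mul]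
  · rw [(hord h0).atomWeight_eq (nsmul_coe_eq_coe.1 hv), mul_div_cancel₀ _ (Nat.cast_ne_zero.2 h0)]

theorem exists_sum_nsmul_eq_sharp (hω : IsState ω) (hatom : ∀ a, l a ≠ 0 → IsAtom a)
    (hord : ∀ a, l a ≠ 0 → HasOrd a (l a)) {F : Finset E}
    (hF : ∑ a ∈ F, l a • (a : WithTop E) ≠ ⊤) :
    ∃ c : sharp E, ∑ a ∈ F, l a • (a : WithTop E) = (c : E) ∧
      ω c = ∑ a ∈ F, l a * atomWeight ω a := by
  obtain ⟨w, hw⟩ := exists_nsmul_eq_sharp hatom hord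
  have hωw (a : E) : ω (w a) = l a * atomWeight ω a := map_eq_mul_atomWeight hω (hord a) (hw a)
  simp only [hw, ← hωw] at hF ⊢
  obtain ⟨c, hc, hc'⟩ := exists_sum_sharp_eq hF
  exact ⟨c, hc', hω.map_sum hc⟩

theorem IsAtomicSum.hasSum_of_hasOrd (hω : IsState ω) (hc : IsOrderContinuous ω)
    (hl : IsAtomicSum l v) (hord : ∀ a, l a ≠ 0 → HasOrd a (l a)) :
    HasSum (fun a => l a * atomWeight ω a) (ω v) := by
  have hpartial (F : Finset E) := exists_sum_nsmul_eq_sharp hω hl.isAtom hord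
    (ne_top_of_le_ne_top WithTop.coe_ne_top (hl.hasOplusSum.sum_le F))
  choose c hc_eq hωc using hpartial
  have hmono : Monotone c := fun F G hFG => by
    have hle := monotone_partialSum (fun a => l a • (a : WithTop E)) hFG
    simpa only [hc_eq, WithTop.coe_le_coe, Subtype.coe_le_coe] using hle
  have hlub : IsLUB (Set.range c) v := by
    refine ⟨Set.forall_mem_range.2 fun F => ?_, fun w hw => ?_⟩
    · exact Subtype.coe_le_coe.1 (WithTop.coe_le_coe.1 (hc_eq F ▸ hl.hasOplusSum.sum_le F))
    · refine Subtype.coe_le_coe.1 (WithTop.coe_le_coe.1 (hl.hasOplusSum.2 ?_))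
      refine Set.forall_mem_range.2 fun F => ?_
      rw [hc_eq, WithTop.coe_le_coe, Subtype.coe_le_coe]
      exact hw ⟨F, rfl⟩
  simpa only [HasSum, SummationFilter.unconditional_filter, hωc] using
    hc.tendsto_of_monotone hmono hlub

theorem IsAtomicSum.exists_ge_hasOrd (hA : IsArchimedean E) (hh : IsAtomicSum h x) :
    ∃ l : E → ℕ, h ≤ l ∧ ∀ a, l a ≠ 0 → h a ≠ 0 ∧ HasOrd a (l a) := by
  have hex (a : E) : ∃ n, h a ≤ n ∧ (n ≠ 0 → h a ≠ 0 ∧ HasOrd a n) := by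
    by_cases ha : h a = 0
    · exact ⟨0, ha.le, fun h0 => absurd rfl h0⟩
    obtain ⟨n, hn⟩ := hA.exists_hasOrd (hh.isAtom a ha).1
    have hdef : h a • (a : WithTop E) ≠ ⊤ := ne_top_of_le_ne_top WithTop.coe_ne_top (hh.nsmul_le a)
    exact ⟨n, hn.2 (nsmul_coe_ne_top_iff.1 hdef), fun _ => ⟨ha, hn⟩⟩
  choose l hhl hl using hex
  exact ⟨l, hhl, hl⟩

theorem IsAtomicSum.summable (hA : IsArchimedean E) (hω : IsState ω) (hh : IsAtomicSum h x) :
    Summable fun a => h a * atomWeight ω a := by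
  obtain ⟨l, hhl, hl⟩ := hh.exists_ge_hasOrd hA
  have hatom (a : E) (ha : l a ≠ 0) : IsAtom a := hh.isAtom a (hl a ha).1
  have hdef (a : E) : l a • (a : WithTop E) ≠ ⊤ := by
    obtain h0 | h0 := eq_or_ne (l a) 0
    · rw [h0, zero_nsmul]
      exact WithTop.coe_ne_top
    · exact (hasOrd_iff.1 (hl a h0).2).1
  have hpair := pairwise_nsmul_mem_orthDisjoint hatom fun a b hab ha hb =>
    hh.coe_add_coe_ne_top hab (hl a ha).1 (hl b hb).1
  refine summable_of_sum_le (c := 1)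
    (fun a => mul_nonneg (Nat.cast_nonneg _) (atomWeight_nonneg hω a)) fun F => ?_
  obtain ⟨c, -, hωc⟩ :=
    exists_sum_nsmul_eq_sharp hω hatom (fun a ha => (hl a ha).2) (sum_ne_top hpair hdef F)
  calc ∑ a ∈ F, h a * atomWeight ω a ≤ ∑ a ∈ F, l a * atomWeight ω a :=
        Finset.sum_le_sum fun a _ =>
          mul_le_mul_of_nonneg_right (Nat.cast_le.2 (hhl a)) (atomWeight_nonneg hω a)
    _ = ω c := hωc.symm
    _ ≤ 1 := (hω.mem_Icc c).2

/-- A basic decomposition of `x`, with a junk value when there is none. -/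
noncomputable def basicDecomposition (x : E) : sharp E × (E → ℕ) :=
  Classical.epsilon fun d => IsBasicDecomposition x d.1 d.2

/-- The state smearing of `ω`: it agrees with `ω` on the sharp part of a basic decomposition and
takes the value `atomWeight ω a` at the atoms `a`. -/
noncomputable def smearing (ω : sharp E → ℝ) (x : E) : ℝ :=
  ω (basicDecomposition x).1 + ∑' a, (basicDecomposition x).2 a * atomWeight ω a

variable [IsAtomic E]

theorem IsBasicDecomposition.smearing_eq (hA : IsArchimedean E) (hS : IsSharplyDominating E)
    (hd : IsBasicDecomposition x v k) :
    smearing ω x = ω v + ∑' a, k a * atomWeight ω a := by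
  have hex : ∃ d : sharp E × (E → ℕ), IsBasicDecomposition x d.1 d.2 := ⟨(v, k), hd⟩
  have heq : basicDecomposition x = (v, k) :=
    (existsUnique_isBasicDecomposition hA hS x).unique (Classical.epsilon_spec hex) hd
  rw [smearing, heq]

theorem IsAtomicSum.hasSum_smearing (hA : IsArchimedean E) (hS : IsSharplyDominating E)
    (hω : IsState ω) (hc : IsOrderContinuous ω) (hh : IsAtomicSum h x) :
    HasSum (fun a => h a * atomWeight ω a) (smearing ω x) := by
  obtain ⟨v, hsharp, hd⟩ := hh.exists_isBasicDecomposition hS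
  obtain ⟨-, s, hunsharp, -⟩ := isBasicDecomposition_iff.1 hd
  have hsum := (hsharp.hasSum_of_hasOrd hω hc fun _ => hasOrd_sharpPart).add
    (hunsharp.summable hA hω).hasSum
  rw [← hd.smearing_eq hA hS] at hsum
  convert hsum using 2 with a
  rw [← add_mul, ← Nat.cast_add, ← Pi.add_apply, sharpPart_add_unsharpPart]

theorem smearing_coe (hA : IsArchimedean E) (hS : IsSharplyDominating E) (v : sharp E) :
    smearing ω (v : E) = ω v := by
  simp [(isBasicDecomposition_sharp v).smearing_eq hA hS]

theorem smearing_atom (hA : IsArchimedean E) (hS : IsSharplyDominating E) (hω : IsState ω)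
    (hc : IsOrderContinuous ω) (ha : IsAtom a) : smearing ω a = atomWeight ω a := by
  classical
  refine ((IsAtomicSum.single ha).hasSum_smearing hA hS hω hc).unique ?_
  simpa using hasSum_single (f := fun b => (Pi.single a 1 : E → ℕ) b * atomWeight ω b) a
    fun b hb => by simp [hb]

theorem isState_smearing (hA : IsArchimedean E) (hS : IsSharplyDominating E) (hω : IsState ω)
    (hc : IsOrderContinuous ω) : IsState (smearing ω) := by
  have hnonneg (x : E) : 0 ≤ smearing ω x := by
    obtain ⟨h, hh⟩ := exists_isAtomicSum hA x
    exact (hh.hasSum_smearing hA hS hω hc).nonneg fun a =>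
      mul_nonneg (Nat.cast_nonneg _) (atomWeight_nonneg hω a)
  have hadd (x y z : E) (hxy : oplus x y = some z) :
      smearing ω z = smearing ω x + smearing ω y := by
    obtain ⟨h, hh⟩ := exists_isAtomicSum hA x
    obtain ⟨k, hk⟩ := exists_isAtomicSum hA y
    refine ((hh.add hk hxy).hasSum_smearing hA hS hω hc).unique ?_
    simpa only [Pi.add_apply, Nat.cast_add, add_mul] using
      (hh.hasSum_smearing hA hS hω hc).add (hk.hasSum_smearing hA hS hω hc)
  have hone : smearing ω (1 : E) = 1 := (smearing_coe hA hS 1).trans hω.map_one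
  refine ⟨fun x => ⟨hnonneg x, ?_⟩, hone, hadd⟩
  linarith [hadd x (orth x) 1 (oplus_orth x), hnonneg (orth x)]

theorem IsBasicDecomposition.isLUB_smearing (hA : IsArchimedean E) (hS : IsSharplyDominating E)
    (hω : IsState ω) (hc : IsOrderContinuous ω) (hd : IsBasicDecomposition x v k) :
    IsLUB (Set.range fun K : Finset {a : E // k a ≠ 0} => ∑ a ∈ K, (k a : ℝ) * smearing ω a.1)
      (∑' a, k a * atomWeight ω a) := by
  obtain ⟨-, s, hk, -⟩ := isBasicDecomposition_iff.1 hd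
  have hatom (a : {a : E // k a ≠ 0}) : smearing ω a.1 = atomWeight ω a.1 :=
    smearing_atom hA hS hω hc (hd.isAtom a a.2)
  have hsupp : (Function.support fun a => k a * atomWeight ω a) ⊆ {a | k a ≠ 0} :=
    fun a ha hka => ha (by simp [hka])
  have hsum := (hasSum_subtype_iff_of_support_subset hsupp).2 (hk.summable hA hω).hasSum
  simp only [hatom]
  exact isLUB_hasSum (fun a => mul_nonneg (Nat.cast_nonneg _) (atomWeight_nonneg hω _)) hsum

theorem exists_nsmul_atom_sharp (hA : IsArchimedean E) (hS : IsSharplyDominating E)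
    (hω : IsState ω) (hc : IsOrderContinuous ω) (ha : IsAtom a) :
    ∃ (n : ℕ) (w : sharp E), 0 < n ∧ HasOrd a n ∧ mult n a = some (w : E) ∧
      smearing ω a = ω w / n := by
  obtain ⟨n, hn⟩ := hA.exists_hasOrd ha.1
  obtain ⟨w, hw⟩ := hn.1
  have hw_sharp : w ∈ sharp E := hn.nsmul_mem_sharp ha (nsmul_coe_eq_coe.2 hw)
  refine ⟨n, ⟨w, hw_sharp⟩, hn.pos, hn, hw, ?_⟩
  rw [smearing_atom hA hS hω hc ha, hn.atomWeight_eq (v := ⟨w, hw_sharp⟩) hw]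

end Smearing

end EffectAlgebra

open EffectAlgebra in
theorem theorem4p2 {E : Type u} [LatticeEffectAlgebra E] [IsAtomic E]
    (hA : IsArchimedean E) (hS : IsSharplyDominating E)
    (ω : sharp E → ℝ) (hω : IsState ω) (hc : IsOrderContinuous ω) :
    -- basic decompositions exist and are unique
    (∀ x : E, ∃! d : sharp E × (E → ℕ), IsBasicDecomposition x d.1 d.2) ∧
    ∃ ω' : E → ℝ, IsState ω' ∧
      -- `ω'` extends `ω`
      (∀ x : sharp E, ω' x = ω x) ∧
      -- for every atom `a`, the element `n_a a` is sharp and `ω' a = ω (n_a a) / n_a`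
      (∀ a : E, IsAtom a → ∃ (n : ℕ) (w : sharp E), 0 < n ∧ HasOrd a n ∧
        mult n a = some (w : E) ∧ ω' a = ω w / n) ∧
      -- the value of `ω'` at `x` in terms of the basic decomposition of `x`
      (∀ (x : E) (v : sharp E) (k : E → ℕ), IsBasicDecomposition x v k →
        ∃ r : ℝ, IsLUB (Set.range fun K : Finset {a : E // k a ≠ 0} =>
            ∑ a ∈ K, (k a : ℝ) * ω' a) r ∧
          ω' x = ω v + r) := by
  exact ⟨existsUnique_isBasicDecomposition hA hS, smearing ω, isState_smearing hA hS hω hc,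
    smearing_coe hA hS, fun a ha => exists_nsmul_atom_sharp hA hS hω hc ha, fun x v k hd =>
    ⟨∑' a, k a * atomWeight ω a, hd.isLUB_smearing hA hS hω hc, hd.smearing_eq hA hS⟩⟩
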